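/- Let $V$ be a real inner product space of dimension $9$ with orthonormal basis $e_0,\dots,e_8$, and let $\mathrm{Cl}_+(9)$ be its Clifford algebra, i.e. the unital real associative algebra generated by $V$ with $v\cdot v=\langle v,v\rangle 1$ for $v\in V$ (so $e_i^2=1$ and $e_ie_j+e_je_i=0$ for $i\neq j$). Let $\mathrm{Pin}_+(9)$ be the subgroup of the group of invertible elements of $\mathrm{Cl}_+(9)$ generated by the unit vectors of $V$, and let $\mathrm{Spin}(9)\subset\mathrm{Pin}_+(9)$ be the subgroup of its even elements. Let $I_0,\dots,I_8$ be real $16\times16$ matrices with $$I_iI_j+I_jI_i=0\ (i\ne j),\qquad I_i^2=\mathrm{I},\qquad I_i^T=I_i,\qquad \operatorname{tr} I_i=0,\qquad i,j=0,\dots,8,$$ and let $\rho$ be the restriction to $\mathrm{Spin}(9)$ of the unique homomorphism of unital real algebras $\mathrm{Cl}_+(9)\to M_{16}(\mathbb R)$ with $e_i\mapsto I_i$ (the spin representation). Then $\rho(\mathrm{Spin}(9))\subset\mathrm{SO}(16)$; for all $0\le i<j\le 8$ and $t\in\mathbb R$, $$\exp(t\,I_iI_j)=\cos t\cdot \mathrm{I}+\sin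 t\cdot I_iI_j;$$ and the group $\rho(\mathrm{Spin}(9))$ is generated by the elements $\exp(t\,I_iI_j)$, $0\le i<j\le 8$, $t\in\mathbb R$. -/

import Mathlib

noncomputable section

namespace SpinNine

open CliffordAlgebra

/-- The positive definite quadratic form `v ↦ ⟨v, v⟩` of a real inner product space. -/
def normForm (V : Type*) [NormedAddCommGroup V] [InnerProductSpace ℝ V] : QuadraticForm ℝ V :=
  LinearMap.BilinMap.toQuadraticMap (innerₗ V)

/-- The Clifford algebra `Cl₊(V)`, in which `v * v = ⟨v, v⟩` for every vector `v`. -/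
abbrev Cl (V : Type*) [NormedAddCommGroup V] [InnerProductSpace ℝ V] : Type _ :=
  CliffordAlgebra (normForm V)

/-- `Pin₊(V)`: the subgroup of the group of invertible elements of `Cl₊(V)` generated by the
vectors of length one. -/
def Pin (V : Type*) [NormedAddCommGroup V] [InnerProductSpace ℝ V] : Subgroup (Cl V)ˣ :=
  Subgroup.closure {u | ∃ v : V, ‖v‖ = 1 ∧ (u : Cl V) = ι (normForm V) v}

section

variable {V : Type*} [NormedAddCommGroup V] [InnerProductSpace ℝ V]

theorem normForm_apply (v : V) : normForm V v = ‖v‖ ^ 2 := by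
  simp [normForm]

/-- The inverse of an element of `Pin₊(V)` is its reversal. -/
theorem inv_eq_reverse {u : (Cl V)ˣ} (hu : u ∈ Pin V) :
    ((u⁻¹ : (Cl V)ˣ) : Cl V) = reverse (u : Cl V) := by
  suffices h : (u : Cl V) * reverse (u : Cl V) = 1 by
    exact (Units.inv_eq_of_mul_eq_one_right h)
  unfold Pin at hu
  induction hu using Subgroup.closure_induction with
  | mem x hx =>
    obtain ⟨v, hv, hx⟩ := hx
    rw [hx, reverse_ι, ι_sq_scalar, normForm_apply, hv]
    simp
  | one => simp
  | mul x y _ _ hx hy =>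
    rw [Units.val_mul, reverse.map_mul, mul_assoc, ← mul_assoc (y : Cl V), hy, one_mul, hx]
  | inv x _ hx =>
    have h1 : ((x⁻¹ : (Cl V)ˣ) : Cl V) = reverse (x : Cl V) := Units.inv_eq_of_mul_eq_one_right hx
    rw [h1, reverse_reverse, ← h1, Units.inv_mul]

end

/-- `Spin(V)`: the subgroup of `Pin₊(V)` consisting of its even elements. -/
def Spin (V : Type*) [NormedAddCommGroup V] [InnerProductSpace ℝ V] : Subgroup (Cl V)ˣ where
  carrier := {u | u ∈ Pin V ∧ (u : Cl V) ∈ even (normForm V)}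
  mul_mem' := fun ha hb =>
    ⟨mul_mem ha.1 hb.1, by rw [Units.val_mul]; exact mul_mem ha.2 hb.2⟩
  one_mem' := ⟨one_mem _, by rw [Units.val_one]; exact one_mem _⟩
  inv_mem' := fun {u} hu =>
    ⟨inv_mem hu.1, by
      rw [inv_eq_reverse hu.1]
      exact (reverse_mem_evenOdd_iff (Q := normForm V) (n := 0)).2 hu.2⟩

/-- Nine endomorphisms `I₀, …, I₈` of `ℝ¹⁶` that are pairwise anticommuting, symmetric, trace-free
involutions. -/
structure IsCliffordSystem (I : Fin 9 → Matrix (Fin 16) (Fin 16) ℝ) : Prop where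
  anticomm : ∀ i j, i ≠ j → I i * I j + I j * I i = 0
  sq : ∀ i, I i * I i = 1
  symm : ∀ i, (I i).transpose = I i
  trace : ∀ i, (I i).trace = 0

/-- Systems as in `IsCliffordSystem` exist. With indices `0, …, 15` read as binary words, the `i`-th
matrix sends the basis vector `b` to `±(b xor pᵢ)`, the sign being the parity of the bitwise
conjunction of `b` and `qᵢ`. -/
theorem exists_isCliffordSystem : ∃ I, IsCliffordSystem I := by
  let p : Fin 9 → Fin 16 := ![0, 1, 3, 5, 7, 9, 11, 13, 15]
  let q : Fin 9 → Fin 16 := ![1, 0, 3, 7, 13, 15, 9, 11, 5]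
  let r : Fin 9 → Fin 16 → Fin 16 := fun i b => b ^^^ p i
  let f : Fin 9 → Fin 16 → ℤ := fun i b =>
    let w : ℕ := (b &&& q i).val
    if (w / 8 + w / 4 + w / 2 + w) % 2 = 0 then 1 else -1
  have h1 : ∀ i j b, r i (r j b) = r j (r i b) := by decide +kernel
  have h2 : ∀ i j, i ≠ j → ∀ b, f i (r j b) * f j b + f j (r i b) * f i b = 0 := by
    decide +kernel
  have h3 : ∀ i b, r i (r i b) = b := by decide +kernel
  have h4 : ∀ i b, f i (r i b) * f i b = 1 := by decide +kernel
  have h5 : ∀ i a b, (if a = r i b then f i b else 0) = if b = r i a then f i a else 0 := by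
    decide +kernel
  have h6 : ∀ i, ∑ a, (if a = r i a then f i a else 0) = 0 := by decide +kernel
  clear_value r f
  have hm : ∀ i j a b, ∑ c, (if a = r i c then (f i c : ℝ) else 0) *
      (if c = r j b then (f j b : ℝ) else 0) =
        if a = r i (r j b) then ((f i (r j b) * f j b : ℤ) : ℝ) else 0 := by
    intro i j a b
    simp [mul_ite, Finset.sum_ite_eq', ite_mul]
  refine ⟨fun i => Matrix.of fun a b => if a = r i b then (f i b : ℝ) else 0, ?_, ?_, ?_, ?_⟩
  · intro i j hij
    ext a b
    simp only [Matrix.add_apply, Matrix.mul_apply, Matrix.of_apply, Matrix.zero_apply, hm, h1 j i]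
    split_ifs
    · exact_mod_cast h2 i j hij b
    · simp
  · intro i
    ext a b
    simp only [Matrix.mul_apply, Matrix.of_apply, Matrix.one_apply, hm, h3, h4, Int.cast_one]
  · intro i
    ext a b
    simp only [Matrix.transpose_apply, Matrix.of_apply]
    exact_mod_cast h5 i b a
  · intro i
    simp only [Matrix.trace, Matrix.diag_apply, Matrix.of_apply]
    exact_mod_cast h6 i

variable {V : Type*} [NormedAddCommGroup V] [InnerProductSpace ℝ V]

theorem constr_mul_self (e : OrthonormalBasis (Fin 9) ℝ V)
    {I : Fin 9 → Matrix (Fin 16) (Fin 16) ℝ} (hI : IsCliffordSystem I) (v : V) :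
    e.toBasis.constr ℝ I v * e.toBasis.constr ℝ I v =
      algebraMap ℝ (Matrix (Fin 16) (Fin 16) ℝ) (normForm V v) := by
  have h : e.toBasis.constr ℝ I v = ∑ i, e.repr v i • I i := by
    simp [Module.Basis.constr_apply_fintype]
  have hn : normForm V v = ∑ i, e.repr v i * e.repr v i := by
    rw [normForm_apply, ← e.repr.norm_map v, EuclideanSpace.norm_sq_eq]
    simp [sq]
  have hc : ∀ i j, I i * I j + I j * I i = if i = j then (2 : ℝ) • 1 else 0 := by
    intro i j
    split_ifs with hij
    · subst hij; rw [hI.sq, two_smul]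
    · exact hI.anticomm i j hij
  have h2 : (2 : ℝ) • ((∑ i, e.repr v i • I i) * ∑ i, e.repr v i • I i) =
      (2 : ℝ) • ∑ i, (e.repr v i * e.repr v i) • (1 : Matrix (Fin 16) (Fin 16) ℝ) := by
    have hs : ((∑ i, e.repr v i • I i) * ∑ i, e.repr v i • I i) =
        ∑ i, ∑ j, (e.repr v i * e.repr v j) • (I i * I j) := by
      rw [Finset.sum_mul_sum]
      simp only [smul_mul_smul_comm]
    have hs' : ((∑ i, e.repr v i • I i) * ∑ i, e.repr v i • I i) =
        ∑ i, ∑ j, (e.repr v i * e.repr v j) • (I j * I i) := by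
      rw [hs, Finset.sum_comm]
      simp only [mul_comm]
    rw [two_smul]
    nth_rewrite 1 [hs]
    rw [hs']
    simp only [← Finset.sum_add_distrib, ← smul_add, hc, smul_ite, smul_zero, Finset.sum_ite_eq,
      Finset.mem_univ, if_true, Finset.smul_sum]
    exact Finset.sum_congr rfl fun i _ => smul_comm _ _ _
  rw [h, hn, Algebra.algebraMap_eq_smul_one, Finset.sum_smul]
  exact smul_right_injective _ (two_ne_zero : (2 : ℝ) ≠ 0) h2

/-- The representation `ρ` of the Clifford algebra on `ℝ¹⁶` determined by `ρ (eᵢ) = Iᵢ`. -/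
def cliffordRep (e : OrthonormalBasis (Fin 9) ℝ V)
    {I : Fin 9 → Matrix (Fin 16) (Fin 16) ℝ} (hI : IsCliffordSystem I) :
    Cl V →ₐ[ℝ] Matrix (Fin 16) (Fin 16) ℝ :=
  CliffordAlgebra.lift (normForm V) ⟨e.toBasis.constr ℝ I, constr_mul_self e hI⟩

/-- The spin representation `ρ : Spin(9) → GL(16, ℝ)`: the restriction to the spin group of the
Clifford representation. -/
def spinRep (e : OrthonormalBasis (Fin 9) ℝ V)
    {I : Fin 9 → Matrix (Fin 16) (Fin 16) ℝ} (hI : IsCliffordSystem I) :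
    Spin V →* GL (Fin 16) ℝ :=
  (Units.map (cliffordRep e hI : Cl V →* Matrix (Fin 16) (Fin 16) ℝ)).comp (Spin V).subtype

end SpinNine

end

namespace SpinNine

open CliffordAlgebra

/-! Let `G` be the group generated by the rotors `exp (t Iᵢ Iⱼ)`. Conjugation by rotors turns
coordinate planes, so every unit combination of the `Iᵢ` can be rotated onto `I₀`. As `I₀` inverts
the rotors in planes through it, this puts the image of each unit vector in `G I₀`
(`exists_rotorGroup_mul_eq_sum`). Hence a product of unit vectors lands in `G` or `G I₀` according
to parity (`cliffordRep_mem_of_mem_pin`), and `Spin` lands in `G`. Conversely each rotor is the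
image of a product of two unit vectors. Rotors are orthogonal, and squares of rotors, so they have
determinant one. -/

theorem exp_smul_of_mul_self_eq_neg_one {n : Type*} [Fintype n] [DecidableEq n]
    {J : Matrix n n ℝ} (hJ : J * J = -1) (t : ℝ) :
    NormedSpace.exp (t • J) = Real.cos t • (1 : Matrix n n ℝ) + Real.sin t • J := by
  let _ : NormedRing (Matrix n n ℝ) := Matrix.linftyOpNormedRing
  let _ : NormedAlgebra ℝ (Matrix n n ℝ) := Matrix.linftyOpNormedAlgebra
  -- Sending `Complex.I` to `J` is a continuous algebra map from `ℂ`, so it carries Euler's formula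
  -- to `J`.
  have hf : Continuous (Complex.liftAux J hJ) :=
    LinearMap.continuous_of_finiteDimensional (Complex.liftAux J hJ).toLinearMap
  have h := NormedSpace.map_exp (Complex.liftAux J hJ) hf (t * Complex.I)
  rw [← Complex.exp_eq_exp_ℂ, Complex.liftAux_apply, Complex.liftAux_apply,
    Complex.exp_ofReal_mul_I_re, Complex.exp_ofReal_mul_I_im] at h
  simp only [Complex.re_ofReal_mul, Complex.im_ofReal_mul, Complex.I_re, Complex.I_im, mul_zero,
    mul_one, map_zero, zero_add, Algebra.algebraMap_eq_smul_one] at h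
  exact h.symm

/-! ### Rotor algebra of two anticommuting involutions -/

section Ring

variable {A : Type*} [Ring A] {a b : A}

theorem mul_mul_self_of_anticomm (ha : a * a = 1) (hb : b * b = 1) (hab : a * b + b * a = 0) :
    a * b * (a * b) = -1 := by
  rw [mul_assoc, ← mul_assoc b, eq_neg_of_add_eq_zero_right hab, neg_mul, mul_neg, mul_assoc a b b,
    hb, mul_one, ha]

/-- Two sign changes cancel. This is why a rotor fixes the directions orthogonal to its plane. -/
theorem commute_mul_of_anticomm {c : A} (hac : a * c + c * a = 0) (hbc : b * c + c * b = 0) :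
    Commute (a * b) c := by
  have h1 := eq_neg_of_add_eq_zero_right hac
  have h2 := eq_neg_of_add_eq_zero_left hbc
  rw [Commute, SemiconjBy, mul_assoc, h2, mul_neg, ← mul_assoc, ← mul_assoc, h1, neg_mul]

variable [Algebra ℝ A]

theorem mul_rotor_conj (ha : a * a = 1) (hab : a * b + b * a = 0) (p q : ℝ) :
    a * (p • 1 - q • (a * b)) = (p • 1 + q • (a * b)) * a := by
  have h : a * b * a = -b := by
    rw [mul_assoc, eq_neg_of_add_eq_zero_right hab, mul_neg, ← mul_assoc, ha, one_mul]
  have h' : a * (a * b) = b := by rw [← mul_assoc, ha, one_mul]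
  rw [mul_sub, add_mul, mul_smul_comm, mul_smul_comm, smul_mul_assoc, smul_mul_assoc, h, h', mul_one,
    one_mul, smul_neg, sub_eq_add_neg]

/-- Rotors of one plane multiply like complex numbers, `a * b` playing the imaginary unit. -/
theorem rotor_mul_rotor (hJ : a * b * (a * b) = -1) (p q p' q' : ℝ) :
    (p • 1 + q • (a * b)) * (p' • 1 + q' • (a * b)) =
      (p * p' - q * q') • 1 + (p * q' + q * p') • (a * b) := by
  simp only [add_mul, mul_add, smul_mul_smul_comm, hJ, one_mul, mul_one]
  module

theorem rotor_mul_rotor_conj (hJ : a * b * (a * b) = -1) {p q : ℝ} (h : p ^ 2 + q ^ 2 = 1) :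
    (p • 1 + q • (a * b)) * (p • 1 - q • (a * b)) = 1 := by
  have := rotor_mul_rotor hJ p q p (-q)
  rw [neg_smul, ← sub_eq_add_neg] at this
  rw [this, show p * p - q * -q = 1 by linarith, show p * -q + q * p = 0 by ring]
  simp

/-- Conjugation by `p + q a b` rotates the plane of `a` and `b` by twice the angle of `(p, q)`. -/
theorem rotor_conj (ha : a * a = 1) (hb : b * b = 1) (hab : a * b + b * a = 0) {x : A}
    (hx : Commute (a * b) x) {p q : ℝ} (h : p ^ 2 + q ^ 2 = 1) (r : ℝ) :
    (p • 1 + q • (a * b)) * (r • a + x) * (p • 1 - q • (a * b)) =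
      (r * (p ^ 2 - q ^ 2)) • a - (r * (2 * p * q)) • b + x := by
  have hJ := mul_mul_self_of_anticomm ha hb hab
  have hx' : x * (p • 1 - q • (a * b)) = (p • 1 - q • (a * b)) * x := by
    simp only [mul_sub, sub_mul, mul_smul_comm, smul_mul_assoc, hx.eq, mul_one, one_mul]
  have hba : a * b * a = -b := by
    rw [mul_assoc, eq_neg_of_add_eq_zero_right hab, mul_neg, ← mul_assoc, ha, one_mul]
  rw [mul_assoc, add_mul (r • a), hx', smul_mul_assoc, mul_rotor_conj ha hab, mul_add, mul_smul_comm,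
    ← mul_assoc, ← mul_assoc, rotor_mul_rotor_conj hJ h, rotor_mul_rotor hJ, one_mul, add_mul,
    smul_mul_assoc, smul_mul_assoc, one_mul, hba]
  module

end Ring

/-! ### The rotor group and unit vectors -/

variable {I : Fin 9 → Matrix (Fin 16) (Fin 16) ℝ}

theorem IsCliffordSystem.mul_mul_self (hI : IsCliffordSystem I) {i j : Fin 9} (hij : i ≠ j) :
    I i * I j * (I i * I j) = -1 :=
  mul_mul_self_of_anticomm (hI.sq i) (hI.sq j) (hI.anticomm i j hij)

/-- The subgroup of `GL(16, ℝ)` generated by the one-parameter groups `exp (t Iᵢ Iⱼ)`. -/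
def rotorGroup (I : Fin 9 → Matrix (Fin 16) (Fin 16) ℝ) : Subgroup (GL (Fin 16) ℝ) :=
  Subgroup.closure {g : GL (Fin 16) ℝ | ∃ i j : Fin 9, i < j ∧ ∃ t : ℝ,
    (g : Matrix (Fin 16) (Fin 16) ℝ) = NormedSpace.exp (t • (I i * I j))}

theorem exists_mem_rotorGroup (hI : IsCliffordSystem I) {i j : Fin 9} (hij : i < j) (t : ℝ) :
    ∃ u ∈ rotorGroup I, (u : Matrix (Fin 16) (Fin 16) ℝ) =
        Real.cos t • 1 + Real.sin t • (I i * I j) ∧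
      ((u⁻¹ : GL (Fin 16) ℝ) : Matrix (Fin 16) (Fin 16) ℝ) =
        Real.cos t • 1 - Real.sin t • (I i * I j) := by
  have hJ := hI.mul_mul_self hij.ne
  have h := rotor_mul_rotor_conj hJ (Real.cos_sq_add_sin_sq t)
  exact ⟨⟨_, _, h, mul_eq_one_comm.1 h⟩, Subgroup.subset_closure
    ⟨i, j, hij, t, (exp_smul_of_mul_self_eq_neg_one hJ t).symm⟩, rfl, rfl⟩

/-- The rotor of angle `π`; it handles the vector `-I₀` in the base case below. -/
theorem exists_mem_rotorGroup_neg_one (hI : IsCliffordSystem I) :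
    ∃ u ∈ rotorGroup I, (u : Matrix (Fin 16) (Fin 16) ℝ) = -1 := by
  obtain ⟨u, hu, h, -⟩ := exists_mem_rotorGroup hI (show (0 : Fin 9) < 1 by decide) Real.pi
  exact ⟨u, hu, by simpa using h⟩

/-- Every unit combination of the `Iᵢ` supported on `insert 0 s` lies in the coset of `I₀`. -/
theorem exists_rotorGroup_mul_eq_sum_aux (hI : IsCliffordSystem I) (s : Finset (Fin 9)) :
    0 ∉ s → ∀ c : Fin 9 → ℝ, ∑ i ∈ insert 0 s, c i ^ 2 = 1 →
      ∃ u ∈ rotorGroup I, ∑ i ∈ insert 0 s, c i • I i = u * I 0 := by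
  induction s using Finset.induction_on with
  | empty =>
    intro _ c hc
    simp only [insert_empty_eq, Finset.sum_singleton, sq_eq_one_iff] at hc ⊢
    rcases hc with hc | hc
    · exact ⟨1, one_mem _, by simp [hc]⟩
    · obtain ⟨u, hu, h⟩ := exists_mem_rotorGroup_neg_one hI
      exact ⟨u, hu, by simp [hc, h]⟩
  | insert j s hj ih =>
    intro h0 c hc
    have h0j : (0 : Fin 9) ≠ j := fun h => h0 (h ▸ Finset.mem_insert_self _ _)
    have h0s : (0 : Fin 9) ∉ s := fun h => h0 (Finset.mem_insert_of_mem h)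
    rw [Finset.sum_insert h0, Finset.sum_insert hj] at hc ⊢
    -- Polar coordinates in the plane of `I 0` and `I j`: rotating `z` onto the positive real axis
    -- removes the `j`-th coordinate and leaves `‖z‖` as the new coefficient of `I 0`.
    set z : ℂ := ⟨c 0, c j⟩ with hz
    have hr : ‖z‖ ^ 2 = c 0 ^ 2 + c j ^ 2 := by
      rw [← Complex.normSq_eq_norm_sq, Complex.normSq_apply]; ring
    have hs : ∀ i ∈ s, Function.update c 0 ‖z‖ i = c i := fun i hi =>
      Function.update_of_ne (ne_of_mem_of_not_mem hi h0s) _ _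
    obtain ⟨u, hu, hcu⟩ := ih h0s (Function.update c 0 ‖z‖) (by
      rw [Finset.sum_insert h0s, Function.update_self, hr, ← hc,
        Finset.sum_congr rfl fun i hi => by rw [hs i hi], add_assoc])
    rw [Finset.sum_insert h0s, Function.update_self,
      Finset.sum_congr rfl fun i hi => by rw [hs i hi]] at hcu
    -- Half the argument, because conjugation doubles the angle; negative, because of the minus sign
    -- in `rotor_conj`.
    obtain ⟨g, hg, hgv, hgi⟩ := exists_mem_rotorGroup hI (Fin.pos_iff_ne_zero.2 h0j.symm)
      (-(z.arg / 2))
    have hx : Commute (I 0 * I j) (∑ i ∈ s, c i • I i) :=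
      Commute.sum_right _ _ _ fun i hi => Commute.smul_right (commute_mul_of_anticomm
        (hI.anticomm 0 i fun h => h0s (h ▸ hi)) (hI.anticomm j i fun h => hj (h ▸ hi))) _
    have hrot := rotor_conj (hI.sq 0) (hI.sq j) (hI.anticomm 0 j h0j) hx
      (Real.cos_sq_add_sin_sq (-(z.arg / 2))) ‖z‖
    -- Moving `g⁻¹` to the left past `I 0` turns it into `g`, so `g (u I₀) g⁻¹ = g u g I₀`.
    refine ⟨g * u * g, mul_mem (mul_mem hg hu) hg, ?_⟩
    have hcos : ‖z‖ * (Real.cos (-(z.arg / 2)) ^ 2 - Real.sin (-(z.arg / 2)) ^ 2) = c 0 := by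
      rw [← Real.cos_two_mul', mul_neg, Real.cos_neg, mul_div_cancel₀ _ two_ne_zero,
        Complex.norm_mul_cos_arg]
    have hsin : ‖z‖ * (2 * Real.cos (-(z.arg / 2)) * Real.sin (-(z.arg / 2))) = -c j := by
      rw [mul_right_comm, ← Real.sin_two_mul, mul_neg, Real.sin_neg,
        mul_div_cancel₀ _ two_ne_zero, mul_neg, Complex.norm_mul_sin_arg]
    rw [hcu, hcos, hsin, neg_smul, sub_neg_eq_add, add_assoc, mul_assoc, mul_assoc,
      mul_rotor_conj (hI.sq 0) (hI.anticomm 0 j h0j), ← hgv] at hrot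
    rw [← hrot]
    simp only [Units.val_mul, mul_assoc]

theorem exists_rotorGroup_mul_eq_sum (hI : IsCliffordSystem I) (c : Fin 9 → ℝ)
    (hc : ∑ i, c i ^ 2 = 1) : ∃ u ∈ rotorGroup I, ∑ i, c i • I i = u * I 0 := by
  have h := exists_rotorGroup_mul_eq_sum_aux hI (Finset.univ.erase 0) (by simp) c
  rw [Finset.insert_erase (Finset.mem_univ _)] at h
  exact h hc

/-! ### The image of the spin group -/

variable {V : Type*} [NormedAddCommGroup V] [InnerProductSpace ℝ V]

theorem cliffordRep_ι (e : OrthonormalBasis (Fin 9) ℝ V) (hI : IsCliffordSystem I) (v : V) :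
    cliffordRep e hI (ι (normForm V) v) = ∑ i, e.repr v i • I i := by
  simp [cliffordRep, Module.Basis.constr_apply_fintype]

theorem cliffordRep_ι_basis (e : OrthonormalBasis (Fin 9) ℝ V) (hI : IsCliffordSystem I)
    (i : Fin 9) : cliffordRep e hI (ι (normForm V) (e i)) = I i := by
  have h := e.toBasis.constr_basis ℝ I i
  rw [OrthonormalBasis.coe_toBasis] at h
  simpa only [cliffordRep, lift_ι_apply] using h

theorem exists_rotorGroup_mul_eq_cliffordRep_ι (e : OrthonormalBasis (Fin 9) ℝ V)
    (hI : IsCliffordSystem I) {v : V} (hv : ‖v‖ = 1) :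
    ∃ u ∈ rotorGroup I, cliffordRep e hI (ι (normForm V) v) = u * I 0 := by
  rw [cliffordRep_ι]
  refine exists_rotorGroup_mul_eq_sum hI _ ?_
  have h := EuclideanSpace.norm_sq_eq (e.repr v)
  rw [e.repr.norm_map, hv] at h
  simpa using h.symm

theorem ι_mul_self_of_norm_eq_one {v : V} (hv : ‖v‖ = 1) :
    ι (normForm V) v * ι (normForm V) v = 1 := by
  rw [ι_sq_scalar, normForm_apply, hv]; simp

/-- An element of `Pin` has a parity; its image lies in the rotor group if it is even, and in the
coset of `I₀` if it is odd. -/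
theorem cliffordRep_mem_of_mem_pin (e : OrthonormalBasis (Fin 9) ℝ V) (hI : IsCliffordSystem I)
    {u : (Cl V)ˣ} (hu : u ∈ Pin V) :
    (∃ g ∈ rotorGroup I, cliffordRep e hI u = g) ∨
      ((u : Cl V) ∈ evenOdd (normForm V) 1 ∧
        ∃ g ∈ rotorGroup I, cliffordRep e hI u = g * I 0) := by
  -- The induction must carry parity in the even case too, to obtain it after one more vector.
  suffices h : ((u : Cl V) ∈ evenOdd (normForm V) 0 ∧
        ∃ g ∈ rotorGroup I, cliffordRep e hI u = g) ∨
      ((u : Cl V) ∈ evenOdd (normForm V) 1 ∧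
        ∃ g ∈ rotorGroup I, cliffordRep e hI u = g * I 0) from h.imp_left And.right
  have step : ∀ (x y : (Cl V)ˣ) (v : V), ‖v‖ = 1 → (y : Cl V) = ι (normForm V) v →
      (((x : Cl V) ∈ evenOdd (normForm V) 0 ∧
        ∃ g ∈ rotorGroup I, cliffordRep e hI x = g) ∨
      ((x : Cl V) ∈ evenOdd (normForm V) 1 ∧
        ∃ g ∈ rotorGroup I, cliffordRep e hI x = g * I 0)) →
      ((((x * y : (Cl V)ˣ) : Cl V) ∈ evenOdd (normForm V) 0 ∧
        ∃ g ∈ rotorGroup I, cliffordRep e hI (x * y : (Cl V)ˣ) = g) ∨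
      (((x * y : (Cl V)ˣ) : Cl V) ∈ evenOdd (normForm V) 1 ∧
        ∃ g ∈ rotorGroup I, cliffordRep e hI (x * y : (Cl V)ˣ) = g * I 0)) := by
    intro x y v hv hy hx
    obtain ⟨k, hk, hkv⟩ := exists_rotorGroup_mul_eq_cliffordRep_ι e hI hv
    rw [Units.val_mul, map_mul, hy]
    rcases hx with ⟨hx, g, hg, hgx⟩ | ⟨hx, g, hg, hgx⟩
    · refine Or.inr ⟨?_, g * k, mul_mem hg hk, by rw [hgx, hkv, Units.val_mul, mul_assoc]⟩
      simpa using evenOdd_mul_le (normForm V) 0 1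
        (Submodule.mul_mem_mul hx (ι_mem_evenOdd_one (normForm V) v))
    · refine Or.inl ⟨evenOdd_mul_le (normForm V) 1 1
        (Submodule.mul_mem_mul hx (ι_mem_evenOdd_one (normForm V) v)), g * k⁻¹,
          mul_mem hg (inv_mem hk), ?_⟩
      -- The image of `v` is `k I₀` and squares to one, so `I₀` times it is `k⁻¹`; no normality of
      -- the rotor group is needed.
      have h1 : (k : Matrix (Fin 16) (Fin 16) ℝ) * (I 0 * cliffordRep e hI (ι _ v)) = 1 := by
        rw [← mul_assoc, ← hkv, ← map_mul, ι_mul_self_of_norm_eq_one hv, map_one]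
      rw [hgx, Units.val_mul, mul_assoc, Units.inv_eq_of_mul_eq_one_right h1]
  unfold Pin at hu
  induction hu using Subgroup.closure_induction_right with
  | one => exact Or.inl ⟨SetLike.one_mem_graded _, 1, one_mem _, by simp⟩
  | mul_right x _ y hy hx =>
    obtain ⟨v, hv, hy⟩ := hy
    exact step x y v hv hy hx
  | mul_inv_cancel x _ y hy hx =>
    obtain ⟨v, hv, hy⟩ := hy
    refine step x y⁻¹ v hv ?_ hx
    exact Units.inv_eq_of_mul_eq_one_right (by rw [hy, ι_mul_self_of_norm_eq_one hv])

theorem range_spinRep_le (e : OrthonormalBasis (Fin 9) ℝ V) (hI : IsCliffordSystem I) :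
    (spinRep e hI).range ≤ rotorGroup I := by
  rintro _ ⟨⟨u, hu, hev⟩, rfl⟩
  have hval : (spinRep e hI ⟨u, hu, hev⟩ : Matrix (Fin 16) (Fin 16) ℝ) = cliffordRep e hI u := rfl
  rcases cliffordRep_mem_of_mem_pin e hI hu with ⟨g, hg, h⟩ | ⟨hodd, -⟩
  · rwa [Units.ext (hval.trans h)]
  -- An element both even and odd vanishes, but a unit has nonzero image.
  · have h0 : (u : Cl V) = 0 :=
      Submodule.disjoint_def.1 (evenOdd_isCompl (normForm V)).disjoint _ hev hodd
    exact absurd (hval.trans ((congrArg _ h0).trans (map_zero _))) (Units.ne_zero _)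

theorem rotorGroup_le_range_spinRep (e : OrthonormalBasis (Fin 9) ℝ V)
    (hI : IsCliffordSystem I) : rotorGroup I ≤ (spinRep e hI).range := by
  refine (Subgroup.closure_le _).2 ?_
  rintro g ⟨i, j, hij, t, hg⟩
  have hmem : ∀ v : V, ‖v‖ = 1 → ∃ u ∈ Pin V, (u : Cl V) = ι (normForm V) v := fun v hv =>
    ⟨⟨_, _, ι_mul_self_of_norm_eq_one hv, ι_mul_self_of_norm_eq_one hv⟩,
      Subgroup.subset_closure ⟨v, hv, rfl⟩, rfl⟩
  -- The factorization used is `cos t + sin t Iᵢ Iⱼ = Iᵢ (cos t Iᵢ + sin t Iⱼ)`.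
  have hw : ‖Real.cos t • e i + Real.sin t • e j‖ = 1 := by
    have horth : inner ℝ (Real.cos t • e i) (Real.sin t • e j) = 0 := by
      simp [inner_smul_left, inner_smul_right, e.inner_eq_zero hij.ne]
    have h := norm_add_sq_eq_norm_sq_add_norm_sq_real horth
    rw [norm_smul, norm_smul, e.norm_eq_one, e.norm_eq_one, mul_one, mul_one, Real.norm_eq_abs,
      Real.norm_eq_abs, abs_mul_abs_self, abs_mul_abs_self] at h
    nlinarith [Real.cos_sq_add_sin_sq t, norm_nonneg (Real.cos t • e i + Real.sin t • e j)]
  obtain ⟨u, hu, huv⟩ := hmem _ (e.norm_eq_one i)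
  obtain ⟨w, hw, hwv⟩ := hmem _ hw
  refine ⟨⟨u * w, mul_mem hu hw, ?_⟩, Units.ext ?_⟩
  · rw [Units.val_mul, huv, hwv]
    exact ι_mul_ι_mem_evenOdd_zero _ _ _
  · change cliffordRep e hI (u * w : (Cl V)ˣ) = g
    rw [hg, exp_smul_of_mul_self_eq_neg_one (hI.mul_mul_self hij.ne), Units.val_mul, huv, hwv,
      map_mul, map_add, map_smul, map_smul, map_add, map_smul, map_smul, cliffordRep_ι_basis,
      cliffordRep_ι_basis, mul_add, mul_smul_comm, mul_smul_comm, hI.sq]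

/-! ### Rotors in the special orthogonal group -/

theorem rotor_mem_specialOrthogonalGroup (hI : IsCliffordSystem I) {i j : Fin 9} (hij : i ≠ j)
    (t : ℝ) : Real.cos t • 1 + Real.sin t • (I i * I j) ∈
      Matrix.specialOrthogonalGroup (Fin 16) ℝ := by
  have hJ := hI.mul_mul_self hij
  have horth : ∀ s : ℝ, Real.cos s • 1 + Real.sin s • (I i * I j) ∈
      Matrix.orthogonalGroup (Fin 16) ℝ := by
    intro s
    have ht : (Real.cos s • 1 + Real.sin s • (I i * I j)).transpose =
        Real.cos s • 1 - Real.sin s • (I i * I j) := by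
      rw [Matrix.transpose_add, Matrix.transpose_smul, Matrix.transpose_smul, Matrix.transpose_one,
        Matrix.transpose_mul, hI.symm, hI.symm,
        eq_neg_of_add_eq_zero_right (hI.anticomm i j hij), smul_neg, sub_eq_add_neg]
    rw [Matrix.mem_orthogonalGroup_iff, ht]
    exact rotor_mul_rotor_conj hJ (Real.cos_sq_add_sin_sq s)
  refine Matrix.mem_specialOrthogonalGroup_iff.2 ⟨horth t, ?_⟩
  -- A rotor is the square of its half-angle rotor, whose determinant is `±1` by orthogonality.
  have hsq : Real.cos t • 1 + Real.sin t • (I i * I j) =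
      (Real.cos (t / 2) • 1 + Real.sin (t / 2) • (I i * I j)) *
        (Real.cos (t / 2) • 1 + Real.sin (t / 2) • (I i * I j)) := by
    rw [rotor_mul_rotor hJ, ← Real.cos_add, add_comm (Real.cos (t / 2) * _), ← Real.sin_add,
      add_halves]
  have hdet := congrArg Matrix.det ((Matrix.mem_orthogonalGroup_iff _ _).1 (horth (t / 2)))
  rw [Matrix.det_mul, Matrix.det_transpose, Matrix.det_one] at hdet
  rw [hsq, Matrix.det_mul, hdet]

theorem mem_specialOrthogonalGroup_of_mem_rotorGroup (hI : IsCliffordSystem I)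
    {g : GL (Fin 16) ℝ} (hg : g ∈ rotorGroup I) :
    (g : Matrix (Fin 16) (Fin 16) ℝ) ∈ Matrix.specialOrthogonalGroup (Fin 16) ℝ := by
  unfold rotorGroup at hg
  induction hg using Subgroup.closure_induction with
  | mem x hx =>
    obtain ⟨i, j, hij, t, hx⟩ := hx
    rw [hx, exp_smul_of_mul_self_eq_neg_one (hI.mul_mul_self hij.ne)]
    exact rotor_mem_specialOrthogonalGroup hI hij.ne t
  | one => simp
  | mul x y _ _ hx hy => exact mul_mem hx hy
  | inv x _ hx =>
    obtain ⟨h1, h2⟩ := Matrix.mem_specialOrthogonalGroup_iff.1 hx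
    have h3 := (Matrix.mem_orthogonalGroup_iff _ _).1 h1
    rw [Units.inv_eq_of_mul_eq_one_right h3]
    refine Matrix.mem_specialOrthogonalGroup_iff.2 ⟨?_, by rw [Matrix.det_transpose, h2]⟩
    rw [Matrix.mem_orthogonalGroup_iff, Matrix.transpose_transpose]
    exact mul_eq_one_comm.1 h3

end SpinNine

theorem proposition2p1 {V : Type*} [NormedAddCommGroup V] [InnerProductSpace ℝ V]
    (e : OrthonormalBasis (Fin 9) ℝ V)
    (I : Fin 9 → Matrix (Fin 16) (Fin 16) ℝ) (hI : SpinNine.IsCliffordSystem I) :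
    (∀ g ∈ (SpinNine.spinRep e hI).range,
      (g : Matrix (Fin 16) (Fin 16) ℝ) ∈ Matrix.specialOrthogonalGroup (Fin 16) ℝ) ∧
    (∀ i j : Fin 9, i < j → ∀ t : ℝ,
      NormedSpace.exp (t • (I i * I j)) = Real.cos t • 1 + Real.sin t • (I i * I j)) ∧
    (SpinNine.spinRep e hI).range =
      Subgroup.closure {g : GL (Fin 16) ℝ | ∃ i j : Fin 9, i < j ∧ ∃ t : ℝ,
        (g : Matrix (Fin 16) (Fin 16) ℝ) = NormedSpace.exp (t • (I i * I j))} :=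
  ⟨fun _ hg => SpinNine.mem_specialOrthogonalGroup_of_mem_rotorGroup hI
      (SpinNine.range_spinRep_le e hI hg),
    fun _ _ hij => SpinNine.exp_smul_of_mul_self_eq_neg_one (hI.mul_mul_self hij.ne),
    le_antisymm (SpinNine.range_spinRep_le e hI) (SpinNine.rotorGroup_le_range_spinRep e hI)⟩
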